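/- Let $\mathcal G(n,p)$ be the binomial random graph on $n$ labelled vertices with edge probability $p=p(n)\in[0,1]$. An event holds a.a.s. if its probability tends to $1$ as $n\to\infty$. In an $r$-colouring of the edges of a graph $G$ (an arbitrary assignment of one of $r$ colours to each edge), a monochromatic component is a connected component of the spanning subgraph of $G$ formed by all edges of one colour. For $r\ge 2$ let $d_r$ be the supremum of all $d\in[0,1]$ such that, for every $p=p(n)$ with $pn\to\infty$, a.a.s. every $r$-colouring of the edges of $\mathcal G(n,p)$ has a monochromatic component on at least $dn$ vertices. **Theorem.** (i) Let $r\ge 2$ be an integer, $\alpha>0$, and $p=p(n)$ with $pn\to\infty$. Then a.a.s. every $r$-colouring of the edges of $\mathcal G(n,p)$ has a monochromatic component on at least $\left(\frac1{r-1}-\alpha\right)n$ vertices. Consequently $d_r\ge\frac1{r-1}$ for every $r\ge2$. (ii) The constant $\frac1{r-1}$ is optimal for infinitely many $r$: if $r=2$ or $r-1$ is a prime power, then $d_r=\frac1{r-1}$ and, for every $\beta>0$ and every $p=p(n)$, a.a.s. there is an $r$-colouring of the edges of $\mathcal G(n,p)$ in which every monochromatic component has at most $\left(\frac1{r-1}+\beta\right)n$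 vertices. In particular, $d_r=\frac1{r-1}$ for infinitely many $r$. -/

import Mathlib

open Filter Topology

/-- In the edge colouring `C` of `G`, some monochromatic connected component (a connected component
of the graph formed by all edges of one colour) has at least `m` vertices. -/
def HasMonoComponent {V K : Type*} {G : SimpleGraph V} (C : G.EdgeLabeling K) (m : ℝ) : Prop :=
  ∃ k : K, ∃ c : (C.labelGraph k).ConnectedComponent, m ≤ (c.supp.ncard : ℝ)

/-- Every colouring of the edges of `G` with `r` colours (not necessarily proper, not necessarily
using all the colours) has a monochromatic component on at least `m` vertices. -/
def ForcesMonoComponent {V : Type*} (r : ℕ) (m : ℝ) (G : SimpleGraph V) : Prop :=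
  ∀ C : G.EdgeLabeling (Fin r), HasMonoComponent C m

/-- The property `P` holds asymptotically almost surely for the binomial random graph `G(n, p)`,
`p = p(n)`: the probability that it holds tends to `1` as `n → ∞`. -/
def HoldsAAS (p : ℕ → unitInterval) (P : ∀ n : ℕ, SimpleGraph (Fin n) → Prop) : Prop :=
  Tendsto (fun n : ℕ => SimpleGraph.binomialRandom (Fin n) (p n) {G | P n G}) atTop (𝓝 1)

/-- The expected degree `p n` tends to infinity. -/
def DegreeToInfinity (p : ℕ → unitInterval) : Prop :=
  Tendsto (fun n : ℕ => (p n : ℝ) * (n : ℝ)) atTop atTop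

/-- The constant `d_r`: the supremum of all `d ∈ [0, 1]` such that, whenever `p n → ∞`, a.a.s. every
`r`-colouring of the edges of `G(n, p)` has a monochromatic component on at least `d n` vertices. -/
noncomputable def monoComponentConst (r : ℕ) : ℝ :=
  sSup {d : ℝ | d ∈ Set.Icc (0 : ℝ) 1 ∧ ∀ p : ℕ → unitInterval, DegreeToInfinity p →
    HoldsAAS p (fun n G => ForcesMonoComponent r (d * n) G)}

/-! Lower bound: the only randomness used is that, when `p n → ∞`, a.a.s. any two disjoint sets of
at least `δ n` vertices span an edge, by a union bound over at most `4 ^ n` pairs of sets. Given a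
colouring, the components of each colour are merged into boundedly many blocks, each exceeding the
largest component by at most a small multiple of `n`. The block vectors split the vertices into
boundedly many cells, and all but few vertices lie in large cells. Two large cells are joined by an
edge, so they share a block in its colour. Vertices of large cells thus behave as in a coloured
complete graph: any two agree in one of `r` labellings, and the double counting of
`exists_large_fiber` yields a block holding a `1 / (r - 1)` share (`JoinsLargeSets.card_le`).

Upper bound: this is deterministic. If `q = r - 1` is a prime power, the vertices are spread evenly
over the affine plane of order `q` and each edge is coloured by the direction of a line through the
images of its ends. There are `q + 1 = r` directions, and each monochromatic component stays over
one line, which carries about `n / q` vertices. -/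

section Labellings

open Finset

/-- If each pair in `A × B` is joined by one of the labellings `f i`, `i ∈ I`, then some label class
contains at least a `1 / |I|` fraction of `A ∪ B`. -/
theorem exists_large_fiber_of_bipartite {V L ι : Type*} [DecidableEq L] (A B : Finset V)
    (I : Finset ι) (f : ι → V → L) (hA : A.Nonempty) (hB : B.Nonempty)
    (h : ∀ a ∈ A, ∀ b ∈ B, ∃ i ∈ I, f i a = f i b) :
    ∃ i ∈ I, ∃ l, #A + #B ≤ #I * (#{a ∈ A | f i a = l} + #{b ∈ B | f i b = l}) := by
  classical
  by_contra! hlt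
  -- `T` counts agreeing triples `(i, a, b)`, and `X + Y` sums over them `x i a + y i b`, the size
  -- of their common class. Small classes force `#I * (X + Y) < (#A + #B) * T`; Cauchy–Schwarz with
  -- `#A * #B ≤ T` gives the opposite inequality.
  set x : ι → V → ℕ := fun i a => #{b ∈ B | f i a = f i b} with hx
  set y : ι → V → ℕ := fun i b => #{a ∈ A | f i a = f i b} with hy
  set T := ∑ i ∈ I, ∑ a ∈ A, x i a with hT
  have hT' : T = ∑ i ∈ I, ∑ b ∈ B, y i b := sum_congr rfl fun i _ =>
    sum_card_bipartiteAbove_eq_sum_card_bipartiteBelow (fun a b => f i a = f i b)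
  have hAB : #A * #B ≤ T := by
    rw [hT, sum_comm, ← smul_eq_mul, ← sum_const]
    refine sum_le_sum fun a ha => ?_
    calc #B ≤ #(I.biUnion fun i => {b ∈ B | f i a = f i b}) := card_le_card fun b hb => by
          obtain ⟨i, hi, hab⟩ := h a ha b hb
          exact mem_biUnion.2 ⟨i, hi, mem_filter.2 ⟨hb, hab⟩⟩
      _ ≤ _ := card_biUnion_le
  have hAB0 : 0 < #A * #B := Nat.mul_pos hA.card_pos hB.card_pos
  set X := ∑ i ∈ I, ∑ a ∈ A, x i a ^ 2 with hX
  set Y := ∑ i ∈ I, ∑ b ∈ B, y i b ^ 2 with hY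
  have hX2 : T ^ 2 ≤ #I * #A * X := by
    have := sq_sum_le_card_mul_sum_sq (s := I ×ˢ A) (f := fun z => x z.1 z.2)
    rwa [sum_product, sum_product, card_product] at this
  have hY2 : T ^ 2 ≤ #I * #B * Y := by
    have := sq_sum_le_card_mul_sum_sq (s := I ×ˢ B) (f := fun z => y z.1 z.2)
    rwa [sum_product, sum_product, card_product, ← hT'] at this
  have hXT : X = ∑ i ∈ I, ∑ a ∈ A, ∑ b ∈ B, if f i a = f i b then x i a else 0 := by
    refine sum_congr rfl fun i _ => sum_congr rfl fun a _ => ?_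
    rw [← sum_filter, sum_const, smul_eq_mul, sq]
  have hYT : Y = ∑ i ∈ I, ∑ a ∈ A, ∑ b ∈ B, if f i a = f i b then y i b else 0 := by
    refine sum_congr rfl fun i _ => ?_
    rw [sum_comm]
    refine sum_congr rfl fun a _ => ?_
    rw [← sum_filter, sum_const, smul_eq_mul, sq]
  have hTT : T = ∑ i ∈ I, ∑ a ∈ A, ∑ b ∈ B, if f i a = f i b then 1 else 0 := by
    refine sum_congr rfl fun i _ => sum_congr rfl fun a _ => ?_
    rw [← sum_filter, sum_const, smul_eq_mul, mul_one]
  have hle : #I * (X + Y) + T ≤ (#A + #B) * T := by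
    rw [hXT, hYT, hTT]
    simp only [← sum_add_distrib, mul_sum]
    refine sum_le_sum fun i hi => sum_le_sum fun a _ => sum_le_sum fun b _ => ?_
    split_ifs with hab
    · have := hlt i hi (f i a)
      have h1 : x i a = #{c ∈ B | f i c = f i a} := by simp only [hx, eq_comm]
      have h2 : y i b = #{c ∈ A | f i c = f i a} := by simp only [hy, hab]
      rw [h1, h2, add_comm (#{c ∈ B | f i c = f i a})]
      omega
    · simp
  have hT0 : 0 < T := hAB0.trans_le hAB
  have h1 : (#A + #B) * T ^ 2 ≤ #A * #B * (#I * (X + Y)) := by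
    calc (#A + #B) * T ^ 2 = #B * T ^ 2 + #A * T ^ 2 := by ring
      _ ≤ #B * (#I * #A * X) + #A * (#I * #B * Y) := by gcongr
      _ = _ := by ring
  have h2 : #A * #B * (#I * (X + Y)) < #A * #B * ((#A + #B) * T) :=
    Nat.mul_lt_mul_of_pos_left (by omega) hAB0
  have h3 : #A * #B * ((#A + #B) * T) ≤ T * ((#A + #B) * T) := Nat.mul_le_mul_right _ hAB
  have h4 : T * ((#A + #B) * T) = (#A + #B) * T ^ 2 := by ring
  omega

/-- If any two points of `W` agree under one of `r ≥ 2` labellings, then some label class contains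
at least a `1 / (r - 1)` fraction of `W`. -/
theorem exists_large_fiber {V L : Type*} [DecidableEq L] {r : ℕ} (hr : 2 ≤ r) (W : Finset V)
    (f : Fin r → V → L) (hW : W.Nonempty) (h : ∀ u ∈ W, ∀ v ∈ W, ∃ i, f i u = f i v) :
    ∃ i l, #W ≤ (r - 1) * #{w ∈ W | f i w = l} := by
  classical
  obtain ⟨w, hw⟩ := hW
  let i₀ : Fin r := ⟨0, by omega⟩
  set A := {v ∈ W | f i₀ v = f i₀ w} with hA
  set B := {v ∈ W | ¬ f i₀ v = f i₀ w} with hB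
  have hcard : #A + #B = #W := card_filter_add_card_filter_not _
  rcases B.eq_empty_or_nonempty with hBe | hBn
  · refine ⟨i₀, f i₀ w, ?_⟩
    rw [hBe, card_empty, add_zero] at hcard
    rw [← hcard]
    exact Nat.le_mul_of_pos_left _ (by omega)
  -- Pairs across `A` and `B` never agree under `i₀`, so only `r - 1` labellings are needed.
  · obtain ⟨i, -, l, hl⟩ := exists_large_fiber_of_bipartite A B (univ.erase i₀) f
      ⟨w, by simp [hA, hw]⟩ hBn fun a ha b hb => by
        rw [hA, mem_filter] at ha
        rw [hB, mem_filter] at hb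
        obtain ⟨i, hi⟩ := h a ha.1 b hb.1
        refine ⟨i, mem_erase.2 ⟨?_, mem_univ _⟩, hi⟩
        rintro rfl
        exact hb.2 (hi ▸ ha.2)
    refine ⟨i, l, ?_⟩
    rw [hcard, card_erase_of_mem (mem_univ _), card_univ, Fintype.card_fin] at hl
    refine hl.trans (Nat.mul_le_mul_left _ ?_)
    rw [← card_union_of_disjoint ((disjoint_filter_filter_not W W _).mono (filter_subset _ _)
      (filter_subset _ _))]
    refine card_le_card fun v hv => ?_
    simp only [mem_union, mem_filter] at hv ⊢
    tauto

/-- Classes of size at most `m` can be merged into at most `|V| / q + 1` classes of size at most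
`q + m`. -/
theorem exists_coarsening {V L : Type*} [Fintype V] [Finite L] [DecidableEq L] (g : V → L)
    {q m : ℕ} (hq : 0 < q) (hm : ∀ l, #{v | g v = l} ≤ m) :
    ∃ h : V → Fin (Fintype.card V / q + 1), (∀ u v, g u = g v → h u = h v) ∧
      ∀ j, #{v | h v = j} ≤ q + m := by
  obtain ⟨N, ⟨e⟩⟩ := Finite.exists_equiv_fin L
  -- With the labels linearly ordered by `e`, `c v` counts the vertices of earlier labels; blocks
  -- are cut at multiples of `q`, never inside a class.
  let c : V → ℕ := fun v => #{u | e (g u) < e (g v)}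
  refine ⟨fun v => ⟨c v / q, Nat.lt_succ_of_le (Nat.div_le_div_right (card_le_univ _))⟩,
    fun u v huv => by simp [c, huv], fun j => ?_⟩
  set F : Finset V := {v | (⟨c v / q, _⟩ : Fin (Fintype.card V / q + 1)) = j} with hF
  have hmem : ∀ v ∈ F, c v / q = j := fun v hv => congrArg Fin.val (mem_filter.1 hv).2
  rcases F.eq_empty_or_nonempty with h0 | hne
  · simp [h0]
  obtain ⟨v, hv, hvmax⟩ := exists_max_image F (fun v => e (g v)) hne
  obtain ⟨u, hu, humin⟩ := exists_min_image F (fun v => e (g v)) hne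
  classical
  -- Outside its last class, a block has at most `c v - c u < q` vertices.
  have hsub : F ⊆ (univ.filter (fun w => e (g w) < e (g v)) \
      univ.filter (fun w => e (g w) < e (g u))) ∪ univ.filter (fun w => g w = g v) := fun w hw => by
    simp only [mem_union, Finset.mem_sdiff, mem_filter, mem_univ, true_and, not_lt]
    rcases (hvmax w hw).lt_or_eq with hlt | heq
    · exact Or.inl ⟨hlt, humin w hw⟩
    · exact Or.inr (e.injective heq)
  have hcuv : #(univ.filter (fun w => e (g w) < e (g v)) \
      univ.filter (fun w => e (g w) < e (g u))) = c v - c u := card_sdiff_of_subset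
    (monotone_filter_right _ fun w _ hw => hw.trans_le (humin v hv))
  have h1 := (card_le_card hsub).trans (card_union_le _ _)
  rw [hcuv] at h1
  have h2 : c v < c u + q := by
    have hu' := Nat.div_add_mod (c u) q
    have hv' := Nat.div_add_mod (c v) q
    have := Nat.mod_lt (c v) hq
    rw [hmem u hu] at hu'
    rw [hmem v hv] at hv'
    omega
  have := hm (g v)
  omega

end Labellings

/-! ### Deterministic lower bound -/

/-- Any two disjoint sets of at least `s` vertices of `G` are joined by an edge. -/
def JoinsLargeSets {V : Type*} (s : ℕ) (G : SimpleGraph V) : Prop :=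
  ∀ A B : Finset V, Disjoint A B → s ≤ A.card → s ≤ B.card → ∃ a ∈ A, ∃ b ∈ B, G.Adj a b

open Finset in
/-- The deterministic bound behind the lower bound for monochromatic components: in a graph which
joins any two disjoint `s`-sets, components of size at most `m` in each of `r` colours force the
number of vertices to be small. -/
theorem JoinsLargeSets.card_le {V : Type*} [Fintype V] {G : SimpleGraph V} {r s q m : ℕ}
    (hG : JoinsLargeSets s G) (hr : 2 ≤ r) (hq : 0 < q) (C : G.EdgeLabeling (Fin r))
    (hm : ∀ k, ∀ c : (C.labelGraph k).ConnectedComponent, c.supp.ncard ≤ m) :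
    Fintype.card V ≤ (r - 1) * (q + m) + s * (Fintype.card V / q + 1) ^ r := by
  classical
  choose h hh hcard using fun k => exists_coarsening (C.labelGraph k).connectedComponentMk hq
    (m := m) fun c => by
      refine le_trans (le_of_eq ?_) (hm k c)
      rw [← Set.ncard_coe_finset]
      congr 1
      ext v
      simp [SimpleGraph.ConnectedComponent.mem_supp_iff]
  let cell : V → Fin r → Fin (Fintype.card V / q + 1) := fun v k => h k v
  set W : Finset V := {v | s ≤ #{u | cell u = cell v}} with hW
  have hsmall : #(univ.filter fun v => ¬ s ≤ #{u | cell u = cell v}) ≤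
      s * (Fintype.card V / q + 1) ^ r := by
    refine (card_le_mul_card_image (f := cell) _ s fun b hb => ?_).trans
      (Nat.mul_le_mul_left _ ((card_le_univ _).trans (by simp)))
    obtain ⟨v, hv, rfl⟩ := mem_image.1 hb
    rw [mem_filter, not_le] at hv
    exact (card_le_card (fun u hu => by simpa using (mem_filter.1 hu).2)).trans hv.2.le
  have hsplit := card_filter_add_card_filter_not (s := (univ : Finset V))
    (fun v => s ≤ #{u | cell u = cell v})
  rw [card_univ, ← hW] at hsplit
  have hlarge : #W ≤ (r - 1) * (q + m) := by
    rcases W.eq_empty_or_nonempty with h0 | hne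
    · simp [h0]
    obtain ⟨i, l, hil⟩ := exists_large_fiber hr W h hne fun u hu v hv => by
      by_cases huv : cell u = cell v
      · exact ⟨⟨0, by omega⟩, congrFun huv _⟩
      obtain ⟨a, ha, b, hb, hab⟩ := hG {w | cell w = cell u} {w | cell w = cell v}
        (disjoint_filter.2 fun w _ h1 h2 => huv (h1.symm.trans h2))
        (mem_filter.1 hu).2 (mem_filter.1 hv).2
      refine ⟨C ⟨s(a, b), hab⟩, ?_⟩
      have := hh (C ⟨s(a, b), hab⟩) a b (SimpleGraph.ConnectedComponent.sound
        (SimpleGraph.EdgeLabeling.labelGraph_adj a b |>.2 ⟨hab, rfl⟩).reachable)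
      have h1 := congrFun (mem_filter.1 ha).2 (C ⟨s(a, b), hab⟩)
      have h2 := congrFun (mem_filter.1 hb).2 (C ⟨s(a, b), hab⟩)
      exact h1.symm.trans (this.trans h2)
    refine hil.trans (Nat.mul_le_mul_left _ (le_trans ?_ (hcard i l)))
    exact card_le_card (filter_subset_filter _ (subset_univ _))
  omega

theorem JoinsLargeSets.forcesMonoComponent {r : ℕ} (hr : 2 ≤ r) {α : ℝ} (hα : 0 < α) :
    ∃ δ : ℝ, 0 < δ ∧ ∀ᶠ n : ℕ in atTop, ∀ G : SimpleGraph (Fin n), JoinsLargeSets ⌈δ * n⌉₊ G →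
      ForcesMonoComponent r ((1 / ((r : ℝ) - 1) - α) * n) G := by
  set K : ℝ := 4 / α + 1 with hK
  have hK0 : 0 < K := by positivity
  have hKr : 0 < K ^ r := by positivity
  have hr' : (2 : ℝ) ≤ r := by exact_mod_cast hr
  -- With `q ≈ α n / 4`, `K` bounds the number of blocks per colour, so this `δ` makes the small
  -- cells cost about `α n / 4` vertices.
  refine ⟨α / (4 * K ^ r), by positivity, ?_⟩
  filter_upwards [eventually_gt_atTop ⌈2 * (r + K ^ r) / α⌉₊] with n hn G hG C
  have hn' : 2 * (r + K ^ r) < α * n := by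
    have h1 := (Nat.le_ceil _).trans_lt (Nat.cast_lt (α := ℝ).2 hn)
    rw [div_lt_iff₀ hα] at h1
    linarith
  have hn0 : (0 : ℝ) < n := by
    by_contra! h0
    nlinarith
  by_contra hC
  simp only [HasMonoComponent, not_exists, not_le] at hC
  set t : ℝ := (1 / ((r : ℝ) - 1) - α) * n with ht
  have ht0 : 0 < t := lt_of_le_of_lt (Nat.cast_nonneg _)
    (hC ⟨0, by omega⟩ ((C.labelGraph _).connectedComponentMk ⟨0, by exact_mod_cast hn0⟩))
  set q := ⌈α / 4 * n⌉₊ with hq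
  have hq0 : 0 < q := Nat.ceil_pos.2 (by positivity)
  have hmain := hG.card_le hr hq0 C (m := ⌊t⌋₊) fun k c => Nat.le_floor (hC k c).le
  rw [Fintype.card_fin] at hmain
  have hmain' : (n : ℝ) ≤ ((r : ℝ) - 1) * (q + ⌊t⌋₊) +
      ⌈α / (4 * K ^ r) * n⌉₊ * (((n / q : ℕ) : ℝ) + 1) ^ r := by
    have := Nat.cast_le (α := ℝ).2 hmain
    rw [Nat.cast_add, Nat.cast_mul, Nat.cast_sub (by omega)] at this
    push_cast at this
    exact this
  have h1 : ((n / q : ℕ) : ℝ) + 1 ≤ K := by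
    have hle : α / 4 * n ≤ q := Nat.le_ceil _
    have : ((n / q : ℕ) : ℝ) ≤ n / q := Nat.cast_div_le
    have h3 : (n : ℝ) / q ≤ 4 / α := by
      rw [div_le_div_iff₀ (by exact_mod_cast hq0) hα]
      linarith
    linarith
  have h2 : (q : ℝ) ≤ α / 4 * n + 1 := (Nat.ceil_lt_add_one (by positivity)).le
  have h3 : (⌊t⌋₊ : ℝ) ≤ t := Nat.floor_le ht0.le
  have h4 : (⌈α / (4 * K ^ r) * n⌉₊ : ℝ) ≤ α / (4 * K ^ r) * n + 1 :=
    (Nat.ceil_lt_add_one (by positivity)).le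
  have h5 : (⌈α / (4 * K ^ r) * n⌉₊ : ℝ) * (((n / q : ℕ) : ℝ) + 1) ^ r ≤
      (α / (4 * K ^ r) * n + 1) * K ^ r := by gcongr
  have h6 : (α / (4 * K ^ r) * n + 1) * K ^ r = α * n / 4 + K ^ r := by field_simp
  have h7 : ((r : ℝ) - 1) * (q + ⌊t⌋₊) ≤ ((r : ℝ) - 1) * (α / 4 * n + 1 + t) :=
    mul_le_mul_of_nonneg_left (by linarith) (by linarith)
  have h8 : ((r : ℝ) - 1) * (α / 4 * n + 1 + t) =
      n + ((r : ℝ) - 1) - 3 / 4 * (((r : ℝ) - 1) * (α * n)) := by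
    rw [ht]
    have : (r : ℝ) - 1 ≠ 0 := by linarith
    field_simp
    ring
  have h9 : α * n ≤ ((r : ℝ) - 1) * (α * n) :=
    le_mul_of_one_le_left (by positivity) (by linarith)
  linarith

/-! ### Edges between large sets in the random graph -/

open MeasureTheory ProbabilityTheory unitInterval in
/-- The probability that none of the pairs in `S` is an edge. -/
theorem binomialRandom_forall_notMem_le {V : Type*} [Countable V] (p : unitInterval)
    (S : Finset (Sym2 V)) (hS : ∀ e ∈ S, ¬ e.IsDiag) :
    SimpleGraph.binomialRandom V p {G | ∀ e ∈ S, e ∉ G.edgeSet} ≤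
      ENNReal.ofReal ((1 - p) ^ S.card) := by
  rw [SimpleGraph.binomialRandom_apply]
  refine (measure_mono (t := Set.pi S fun _ => {False}) ?_).trans ?_
  · rintro _ ⟨G, hG, rfl⟩ e he
    simpa using hG e he
  · rw [Measure.infinitePi_pi _ fun _ _ => MeasurableSet.of_discrete]
    rw [Finset.prod_congr rfl (g := fun _ => ENNReal.ofReal (1 - p)), Finset.prod_const,
      ENNReal.ofReal_pow (by linarith [p.2.2])]
    intro e he
    have : ENNReal.ofReal (1 - p) = ((toNNReal (σ p) : NNReal) : ENNReal) := by
      rw [ENNReal.ofReal, ENNReal.coe_inj]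
      ext
      simp [Real.coe_toNNReal _ (show 0 ≤ 1 - (p : ℝ) by linarith [p.2.2])]
    rw [this]
    simp [hS e he]

open MeasureTheory ProbabilityTheory in
theorem binomialRandom_not_joins_le {V : Type*} [Countable V] (p : unitInterval)
    (A B : Finset V) (hAB : Disjoint A B) :
    SimpleGraph.binomialRandom V p {G | ∀ a ∈ A, ∀ b ∈ B, ¬ G.Adj a b} ≤
      ENNReal.ofReal ((1 - p) ^ (A.card * B.card)) := by
  classical
  have hcard : ((A ×ˢ B).image fun z => s(z.1, z.2)).card = A.card * B.card := by
    rw [Finset.card_image_of_injOn, Finset.card_product]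
    rintro ⟨a, b⟩ h ⟨a', b'⟩ h' heq
    simp only [Finset.coe_product, Set.mem_prod, Finset.mem_coe] at h h'
    rcases Sym2.eq_iff.1 heq with ⟨rfl, rfl⟩ | ⟨rfl, rfl⟩
    · rfl
    · exact absurd h'.2 (Finset.disjoint_left.1 hAB h.1)
  rw [← hcard]
  refine (measure_mono ?_).trans (binomialRandom_forall_notMem_le p _ ?_)
  · intro G hG e he
    obtain ⟨z, hz, rfl⟩ := Finset.mem_image.1 he
    exact hG _ (Finset.mem_product.1 hz).1 _ (Finset.mem_product.1 hz).2
  · intro e he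
    obtain ⟨z, hz, rfl⟩ := Finset.mem_image.1 he
    rw [Sym2.mk_isDiag_iff]
    intro h
    exact Finset.disjoint_left.1 hAB (Finset.mem_product.1 hz).1
      (h ▸ (Finset.mem_product.1 hz).2)

open MeasureTheory ProbabilityTheory in
theorem binomialRandom_not_joinsLargeSets_le {V : Type*} [Fintype V] (p : unitInterval) (s : ℕ) :
    SimpleGraph.binomialRandom V p {G | ¬ JoinsLargeSets s G} ≤
      ENNReal.ofReal (4 ^ Fintype.card V * (1 - p) ^ (s * s)) := by
  classical
  let I : Finset (Finset V × Finset V) :=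
    {z | Disjoint z.1 z.2 ∧ s ≤ z.1.card ∧ s ≤ z.2.card}
  have hI : I.card ≤ 4 ^ Fintype.card V := (Finset.card_le_univ _).trans <| by
    rw [Fintype.card_prod, Fintype.card_finset, ← mul_pow]
    norm_num
  have h0 : (0 : ℝ) ≤ 1 - p := by linarith [p.2.2]
  have h1 : (1 - p : ℝ) ≤ 1 := by linarith [p.2.1]
  calc _ ≤ SimpleGraph.binomialRandom V p
        (⋃ z ∈ I, {G | ∀ a ∈ z.1, ∀ b ∈ z.2, ¬ G.Adj a b}) := by
        refine measure_mono fun G hG => ?_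
        simp only [JoinsLargeSets, Set.mem_ofPred_eq] at hG
        push Not at hG
        obtain ⟨A, B, hd, hA, hB, h⟩ := hG
        exact Set.mem_biUnion (x := (A, B)) (by simp [I, hd, hA, hB]) h
    _ ≤ ∑ z ∈ I, SimpleGraph.binomialRandom V p {G | ∀ a ∈ z.1, ∀ b ∈ z.2, ¬ G.Adj a b} :=
        measure_biUnion_finset_le _ _
    _ ≤ ∑ _z ∈ I, ENNReal.ofReal ((1 - p) ^ (s * s)) := by
        refine Finset.sum_le_sum fun z hz => ?_
        obtain ⟨hd, hA, hB⟩ := (Finset.mem_filter.1 hz).2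
        exact (binomialRandom_not_joins_le p _ _ hd).trans <| ENNReal.ofReal_le_ofReal <|
          pow_le_pow_of_le_one h0 h1 (Nat.mul_le_mul hA hB)
    _ = ENNReal.ofReal (I.card * (1 - p) ^ (s * s)) := by
        rw [Finset.sum_const, nsmul_eq_mul, ENNReal.ofReal_mul (by positivity),
          ENNReal.ofReal_natCast]
    _ ≤ _ := by
        refine ENNReal.ofReal_le_ofReal (mul_le_mul_of_nonneg_right ?_ (by positivity))
        exact_mod_cast hI

open MeasureTheory in
-- Only subadditivity is used, so the event need not be measurable.
theorem holdsAAS_of_tendsto_compl {p : ℕ → unitInterval} {P : ∀ n : ℕ, SimpleGraph (Fin n) → Prop}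
    (h : Tendsto (fun n => SimpleGraph.binomialRandom (Fin n) (p n) {G | ¬ P n G}) atTop (𝓝 0)) :
    HoldsAAS p P := by
  have h1 := ENNReal.Tendsto.sub (tendsto_const_nhds (x := (1 : ENNReal))) h (Or.inl (by simp))
  rw [tsub_zero] at h1
  refine tendsto_of_tendsto_of_tendsto_of_le_of_le h1 tendsto_const_nhds (fun n => ?_)
    fun n => prob_le_one
  rw [tsub_le_iff_right, ← measure_univ (μ := SimpleGraph.binomialRandom (Fin n) (p n))]
  exact measure_univ_le_add_compl _

open MeasureTheory in
theorem HoldsAAS.mono {p : ℕ → unitInterval} {P Q : ∀ n : ℕ, SimpleGraph (Fin n) → Prop}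
    (hP : HoldsAAS p P) (h : ∀ᶠ n in atTop, ∀ G, P n G → Q n G) : HoldsAAS p Q :=
  tendsto_of_tendsto_of_tendsto_of_le_of_le' hP tendsto_const_nhds
    (h.mono fun _ hn => measure_mono fun G hG => hn G hG) (Eventually.of_forall fun _ => prob_le_one)

theorem holdsAAS_of_eventually {p : ℕ → unitInterval} {P : ∀ n : ℕ, SimpleGraph (Fin n) → Prop}
    (h : ∀ᶠ n in atTop, ∀ G, P n G) : HoldsAAS p P :=
  HoldsAAS.mono (P := fun _ _ => True) (by simp [HoldsAAS]) (h.mono fun _ hn G _ => hn G)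

theorem DegreeToInfinity.holdsAAS_joinsLargeSets {p : ℕ → unitInterval} (hp : DegreeToInfinity p)
    {δ : ℝ} (hδ : 0 < δ) : HoldsAAS p (fun n G => JoinsLargeSets ⌈δ * n⌉₊ G) := by
  apply holdsAAS_of_tendsto_compl
  have hexp : Tendsto (fun n : ℕ => ENNReal.ofReal (Real.exp (-n))) atTop (𝓝 0) := by
    rw [← ENNReal.ofReal_zero]
    exact ENNReal.tendsto_ofReal
      (Real.tendsto_exp_neg_atTop_nhds_zero.comp tendsto_natCast_atTop_atTop)
  refine tendsto_of_tendsto_of_tendsto_of_le_of_le' tendsto_const_nhds hexp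
    (Eventually.of_forall fun _ => zero_le) ?_
  -- This gives `p s² ≥ 5 n`; since `4 ^ n ≤ exp (4 n)`, a factor `exp (-n)` remains.
  filter_upwards [hp.eventually_ge_atTop ((4 + 1) / δ ^ 2)] with n hn
  refine (binomialRandom_not_joinsLargeSets_le (p n) _).trans (ENNReal.ofReal_le_ofReal ?_)
  rw [Fintype.card_fin]
  have h0 : (0 : ℝ) ≤ 1 - p n := by linarith [(p n).2.2]
  have hp0 : (0 : ℝ) ≤ p n := (p n).2.1
  have h4 : (4 : ℝ) ≤ Real.exp 4 := by linarith [Real.add_one_le_exp (4 : ℝ)]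
  rw [div_le_iff₀ (by positivity)] at hn
  set s := ⌈δ * n⌉₊
  have hs : δ * n ≤ s := Nat.le_ceil _
  have hs2 : (δ * n) * (δ * n) ≤ (s * s : ℕ) := by
    push_cast
    exact mul_le_mul hs hs (by positivity) (by positivity)
  calc (4 : ℝ) ^ n * (1 - p n) ^ (s * s)
      ≤ Real.exp 4 ^ n * Real.exp (-p n) ^ (s * s) := by
        gcongr
        exact Real.one_sub_le_exp_neg _
    _ = Real.exp (n * 4 + (s * s : ℕ) * (-p n)) := by
        rw [← Real.exp_nat_mul, ← Real.exp_nat_mul, ← Real.exp_add]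
    _ ≤ Real.exp (-n) := by
        refine Real.exp_le_exp.2 ?_
        have h5 : (4 + 1) * (n : ℝ) ≤ p n * n * δ ^ 2 * n :=
          mul_le_mul_of_nonneg_right hn (by positivity)
        have h6 : (p n : ℝ) * ((δ * n) * (δ * n)) ≤ p n * (s * s : ℕ) :=
          mul_le_mul_of_nonneg_left hs2 hp0
        linarith

theorem DegreeToInfinity.holdsAAS_forcesMonoComponent {p : ℕ → unitInterval}
    (hp : DegreeToInfinity p) {r : ℕ} (hr : 2 ≤ r) {α : ℝ} (hα : 0 < α) :
    HoldsAAS p (fun n G => ForcesMonoComponent r ((1 / ((r : ℝ) - 1) - α) * n) G) := by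
  obtain ⟨δ, hδ, h⟩ := JoinsLargeSets.forcesMonoComponent hr hα
  exact (hp.holdsAAS_joinsLargeSets hδ).mono h

theorem le_monoComponentConst {r : ℕ} (hr : 2 ≤ r) : 1 / ((r : ℝ) - 1) ≤ monoComponentConst r := by
  have hr' : (2 : ℝ) ≤ r := by exact_mod_cast hr
  have h1 : 1 / ((r : ℝ) - 1) ≤ 1 := by
    rw [div_le_one (by linarith)]
    linarith
  have h0 : 0 < 1 / ((r : ℝ) - 1) := one_div_pos.2 (by linarith)
  refine le_of_forall_lt_imp_le_of_dense fun d hd => ?_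
  have hb : BddAbove {d : ℝ | d ∈ Set.Icc (0 : ℝ) 1 ∧ ∀ p : ℕ → unitInterval, DegreeToInfinity p →
      HoldsAAS p (fun n G => ForcesMonoComponent r (d * n) G)} := ⟨1, fun x hx => hx.1.2⟩
  -- Truncation at `0` keeps the candidate in `[0, 1]` when `d` is negative.
  refine (le_max_left d 0).trans (le_csSup hb ⟨⟨le_max_right _ _, ?_⟩, fun p hp => ?_⟩)
  · exact max_le (hd.le.trans h1) zero_le_one
  · have := hp.holdsAAS_forcesMonoComponent hr (sub_pos.2 (max_lt hd h0))
    simpa only [sub_sub_cancel] using this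

/-! ### Colourings from affine planes -/

/-- The function sending a point of the affine plane to the line of slope `c` through it
(`none` is the vertical direction). -/
def affineLine {F : Type*} [Field F] : Option F → F × F → F
  | none, P => P.1
  | some a, P => P.2 - a * P.1

theorem exists_affineLine_eq {F : Type*} [Field F] (P Q : F × F) :
    ∃ c : Option F, affineLine c P = affineLine c Q := by
  by_cases h : P.1 = Q.1
  · exact ⟨none, h⟩
  · refine ⟨some ((P.2 - Q.2) / (P.1 - Q.1)), ?_⟩
    have : P.1 - Q.1 ≠ 0 := sub_ne_zero.2 h
    simp only [affineLine]
    field_simp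
    ring

theorem card_affineLine_fiber_le {F : Type*} [Field F] [Fintype F] [DecidableEq F] (c : Option F)
    (l : F) : (Finset.univ.filter fun P : F × F => affineLine c P = l).card ≤ Fintype.card F := by
  rw [← Finset.card_univ]
  cases c with
  | none =>
    refine Finset.card_le_card_of_injOn Prod.snd (fun _ _ => by simp) fun P hP Q hQ h => ?_
    have hP : P.1 = l := (Finset.mem_filter.1 hP).2
    have hQ : Q.1 = l := (Finset.mem_filter.1 hQ).2
    exact Prod.ext (hP.trans hQ.symm) h
  | some a =>
    refine Finset.card_le_card_of_injOn Prod.fst (fun _ _ => by simp) fun P hP Q hQ h => ?_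
    have hP : P.2 - a * P.1 = l := (Finset.mem_filter.1 hP).2
    have hQ : Q.2 - a * Q.1 = l := (Finset.mem_filter.1 hQ).2
    refine Prod.ext h ?_
    rw [← hQ, h] at hP
    exact sub_left_injective hP

/-- A map from `Fin n` to a finite type all of whose fibres have nearly equal size. -/
theorem exists_balanced_map (n : ℕ) (X : Type*) [Fintype X] [Nonempty X] [DecidableEq X] :
    ∃ φ : Fin n → X, ∀ x, (Finset.univ.filter fun v => φ v = x).card ≤ n / Fintype.card X + 1 := by
  set N := Fintype.card X with hN
  have hN0 : 0 < N := Fintype.card_pos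
  let e := Fintype.equivFin X
  refine ⟨fun v => e.symm ⟨v % N, Nat.mod_lt _ hN0⟩, fun x => ?_⟩
  rw [← Finset.card_range (n / N + 1)]
  refine Finset.card_le_card_of_injOn (fun v => (v : ℕ) / N) (fun v _ => ?_) fun u hu v hv h => ?_
  · simpa [Nat.lt_succ_iff] using Nat.div_le_div_right v.2.le
  · simp only [Finset.coe_filter, Finset.mem_univ, true_and, Set.mem_ofPred_eq] at hu hv
    have hmod : (u : ℕ) % N = v % N := by
      have := e.symm.injective (hu.trans hv.symm)
      simpa using this
    have h' : (u : ℕ) / N = v / N := h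
    ext
    rw [← Nat.div_add_mod u N, ← Nat.div_add_mod v N, hmod, h']

/-- If any two vertices agree under one of the labellings `f k`, then the edges can be coloured so
that each `k`-coloured component lies in a class of `f k`. -/
theorem exists_edgeLabeling_le_fiber {V K L : Type*} [Fintype V] [DecidableEq L]
    (G : SimpleGraph V) (f : K → V → L) (hf : ∀ u v, ∃ k, f k u = f k v) :
    ∃ C : G.EdgeLabeling K, ∀ k (c : (C.labelGraph k).ConnectedComponent),
      ∃ l, c.supp.ncard ≤ (Finset.univ.filter fun v => f k v = l).card := by
  have hf' : ∀ e : Sym2 V, ∃ k, ∀ u ∈ e, ∀ v ∈ e, f k u = f k v := by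
    intro e
    induction e using Sym2.inductionOn with
    | hf u v =>
      obtain ⟨k, hk⟩ := hf u v
      refine ⟨k, fun x hx y hy => ?_⟩
      rcases Sym2.mem_iff.1 hx with rfl | rfl <;> rcases Sym2.mem_iff.1 hy with rfl | rfl <;>
        simp [hk]
  choose col hcol using hf'
  let C : G.EdgeLabeling K := fun e => col e
  refine ⟨C, fun k c => ?_⟩
  obtain ⟨v, hv⟩ := c.exists_rep
  refine ⟨f k v, ?_⟩
  rw [← Set.ncard_coe_finset]
  refine Set.ncard_le_ncard (fun u hu => ?_) (Set.toFinite _)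
  have hreach : (C.labelGraph k).Reachable u v := SimpleGraph.ConnectedComponent.exact
    (((SimpleGraph.ConnectedComponent.mem_supp_iff c u).1 hu).trans hv.symm)
  simp only [Finset.coe_filter, Finset.mem_univ, true_and, Set.mem_ofPred_eq]
  obtain ⟨w⟩ := hreach
  clear hu hv
  induction w with
  | nil => rfl
  | @cons x y z hadj _ ih =>
    obtain ⟨H, hk⟩ := (SimpleGraph.EdgeLabeling.labelGraph_adj _ _).1 hadj
    have h1 := hcol s(x, y) x (by simp) y (by simp)
    have h2 : col s(x, y) = k := hk
    rw [h2] at h1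
    exact h1.trans ih

theorem exists_edgeLabeling_small_components {r : ℕ} (hr : 2 ≤ r)
    (hq : r = 2 ∨ IsPrimePow (r - 1)) {β : ℝ} (hβ : 0 < β) :
    ∀ᶠ n : ℕ in atTop, ∀ G : SimpleGraph (Fin n), ∃ C : G.EdgeLabeling (Fin r),
      ∀ (k : Fin r) (c : (C.labelGraph k).ConnectedComponent),
        (c.supp.ncard : ℝ) ≤ (1 / ((r : ℝ) - 1) + β) * n := by
  rcases hq with rfl | hq
  · refine Eventually.of_forall fun n G => ⟨fun _ => 0, fun k c => ?_⟩
    have h1 : (c.supp.ncard : ℝ) ≤ n := by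
      exact_mod_cast (Set.ncard_le_card c.supp).trans (by simp)
    have h2 : 0 ≤ β * n := by positivity
    norm_num
    linarith
  · obtain ⟨hF⟩ := (Fintype.nonempty_field_iff (α := Fin (r - 1))).2 (by simpa using hq)
    -- Hiding `Fin (r - 1)` keeps its modular arithmetic apart from the field structure.
    generalize hFdef : Fin (r - 1) = F at hF
    have : Fintype F := hFdef ▸ inferInstance
    have hcard : Fintype.card F = r - 1 := by
      rw [← Nat.card_eq_fintype_card, ← hFdef, Nat.card_fin]
    classical
    have hopt : Fintype.card (Option F) = r := by
      rw [Fintype.card_option, hcard]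
      omega
    let e : Fin r ≃ Option F := (Fintype.equivFinOfCardEq hopt).symm
    set q := Fintype.card F with hqF
    have hq0 : 0 < q := Fintype.card_pos
    have hqr : (r : ℝ) - 1 = q := by
      rw [hcard, Nat.cast_sub (by omega), Nat.cast_one]
    -- Rounding costs at most one vertex at each of the `q` points of a line, and `q ≤ β n`.
    filter_upwards [eventually_ge_atTop ⌈q / β⌉₊] with n hn G
    obtain ⟨φ, hφ⟩ := exists_balanced_map n (F × F)
    obtain ⟨C, hC⟩ := exists_edgeLabeling_le_fiber G (fun k v => affineLine (e k) (φ v))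
      fun u v => by
        obtain ⟨c, hc⟩ := exists_affineLine_eq (φ u) (φ v)
        exact ⟨e.symm c, by simpa using hc⟩
    refine ⟨C, fun k c => ?_⟩
    obtain ⟨l, hl⟩ := hC k c
    have h1 : (Finset.univ.filter fun v => affineLine (e k) (φ v) = l).card ≤
        (n / Fintype.card (F × F) + 1) * q := by
      refine (Finset.card_le_mul_card_image (f := φ) _ (n / Fintype.card (F × F) + 1)
        fun b _ => ?_).trans (Nat.mul_le_mul_left _ ?_)
      · exact (Finset.card_le_card (Finset.filter_subset_filter _ (Finset.subset_univ _))).trans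
          (hφ b)
      · refine (Finset.card_le_card fun P hP => ?_).trans (card_affineLine_fiber_le (e k) l)
        obtain ⟨v, hv, rfl⟩ := Finset.mem_image.1 hP
        simpa using hv
    have h2 : (c.supp.ncard : ℝ) ≤ (((n / (q * q) : ℕ) : ℝ) + 1) * q := by
      rw [Fintype.card_prod] at h1
      exact_mod_cast hl.trans h1
    have h3 : ((n / (q * q) : ℕ) : ℝ) ≤ n / (q * q) := by
      exact_mod_cast Nat.cast_div_le (α := ℝ) (m := n) (n := q * q)
    have h4 : (q : ℝ) ≤ β * n := by
      have := Nat.ceil_le.1 hn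
      rw [div_le_iff₀ hβ] at this
      linarith
    have hq0' : (0 : ℝ) < q := by exact_mod_cast hq0
    rw [hqr]
    calc (c.supp.ncard : ℝ) ≤ (n / (q * q) + 1) * q := h2.trans (by gcongr)
      _ = 1 / q * n + q := by field_simp
      _ ≤ _ := by linarith

/-! ### The value of the constant -/

open MeasureTheory in
theorem monoComponentConst_le {r : ℕ} (hr : 2 ≤ r) (hq : r = 2 ∨ IsPrimePow (r - 1)) :
    monoComponentConst r ≤ 1 / ((r : ℝ) - 1) := by
  have hr' : (2 : ℝ) ≤ r := by exact_mod_cast hr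
  refine Real.sSup_le ?_ (one_div_nonneg.2 (by linarith))
  rintro d ⟨-, hd⟩
  by_contra! hlt
  -- One admissible `p` refutes `d`; the colouring exists for every graph, so `p = 1` suffices.
  have hp : DegreeToInfinity fun _ => 1 := by
    simpa [DegreeToInfinity] using tendsto_natCast_atTop_atTop (R := ℝ)
  have hβ : 0 < (d - 1 / ((r : ℝ) - 1)) / 2 := by linarith
  have h0 : Tendsto (fun n : ℕ => SimpleGraph.binomialRandom (Fin n) 1
      {G | ForcesMonoComponent r (d * n) G}) atTop (𝓝 0) := by
    refine tendsto_const_nhds.congr' ?_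
    filter_upwards [exists_edgeLabeling_small_components hr hq hβ, eventually_gt_atTop 0]
      with n hn hn0
    symm
    refine measure_mono_null (t := ∅) (fun G hG => ?_) measure_empty
    exfalso
    obtain ⟨C, hC⟩ := hn G
    obtain ⟨k, c, hc⟩ := hG C
    have h1 := hc.trans (hC k c)
    have hn0' : (0 : ℝ) < n := by exact_mod_cast hn0
    have := le_of_mul_le_mul_right h1 hn0'
    linarith
  exact zero_ne_one (tendsto_nhds_unique h0 (hd _ hp))

theorem theorem5p3 :
    (∀ r : ℕ, 2 ≤ r →
      (∀ α : ℝ, 0 < α → ∀ p : ℕ → unitInterval, DegreeToInfinity p →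
        HoldsAAS p (fun n G => ForcesMonoComponent r ((1 / ((r : ℝ) - 1) - α) * n) G)) ∧
      1 / ((r : ℝ) - 1) ≤ monoComponentConst r) ∧
    (∀ r : ℕ, 2 ≤ r → (r = 2 ∨ IsPrimePow (r - 1)) →
      monoComponentConst r = 1 / ((r : ℝ) - 1) ∧
      ∀ β : ℝ, 0 < β → ∀ p : ℕ → unitInterval,
        HoldsAAS p (fun n G => ∃ C : G.EdgeLabeling (Fin r), ∀ (k : Fin r)
          (c : (C.labelGraph k).ConnectedComponent),
            (c.supp.ncard : ℝ) ≤ (1 / ((r : ℝ) - 1) + β) * n)) ∧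
    {r : ℕ | 2 ≤ r ∧ monoComponentConst r = 1 / ((r : ℝ) - 1)}.Infinite := by
  have heq : ∀ r : ℕ, 2 ≤ r → (r = 2 ∨ IsPrimePow (r - 1)) →
      monoComponentConst r = 1 / ((r : ℝ) - 1) := fun r hr hq =>
    (monoComponentConst_le hr hq).antisymm (le_monoComponentConst hr)
  refine ⟨fun r hr => ⟨fun α hα p hp => hp.holdsAAS_forcesMonoComponent hr hα,
    le_monoComponentConst hr⟩, fun r hr hq => ⟨heq r hr hq, fun β hβ p =>
      holdsAAS_of_eventually (exists_edgeLabeling_small_components hr hq hβ)⟩, ?_⟩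
  refine (Nat.infinite_setOfPred_prime.image ((add_left_injective 1).injOn)).mono ?_
  rintro _ ⟨q, hq, rfl⟩
  have hq' : q.Prime := hq
  have hr : 2 ≤ q + 1 := hq'.two_le.trans (Nat.le_succ q)
  exact ⟨hr, heq _ hr (Or.inr (by simpa using hq'.isPrimePow))⟩
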